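/- Let $n\ge 1$ and let $\mathcal G$ be a tree with node set $\{1,\dots,n\}$ and edge set $\mathcal E$. For every edge $\{i,j\}\in\mathcal E$ let $f_{ij}=f_{ji}:\mathbb R\to\mathbb R$ be an odd, continuously differentiable function all of whose roots are simple, i.e. $f_{ij}(y)=0$ implies $f_{ij}'(y)\neq 0$. Consider the system $$\dot x_i=\sum_{j\sim i} f_{ij}(x_i-x_j),\qquad i=1,\dots,n,$$ on the invariant subspace $\langle\mathbf 1\rangle^\perp=\{\mathbf x\in\mathbb R^n:\ x_1+\dots+x_n=0\}$. The forward orbit of a point $\mathbf x_0$ is the solution $\mathbf x(t)$ with $\mathbf x(0)=\mathbf x_0$ on its maximal forward interval of existence $[0,T)$, $0<T\le\infty$. An equilibrium $\mathbf p\in\langle\mathbf 1\rangle^\perp$ is called stable if for every $\varepsilon>0$ there is $\delta>0$ such that every solution starting at a point of $\langle\mathbf 1\rangle^\perp$ at distance less than $\delta$ from $\mathbf p$ exists for all $t\ge 0$ and stays at distance less than $\varepsilon$ from $\mathbf p$. Then every point of $\langle\mathbf 1\rangle^\perp$ has a forward orbit, and for Lebesgue-almost every $\mathbf x_0\in\langle\mathbf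 1\rangle^\perp$ this forward orbit either exists for all $t\ge0$ and converges to a stable equilibrium as $t\to\infty$, or is unbounded (on $[0,T)$). Moreover, the set of stable equilibria is exactly $$\left\{\mathbf x\in\langle\mathbf 1\rangle^\perp:\ f_{ij}(x_i-x_j)=0\ \text{and}\ f_{ij}'(x_i-x_j)<0\ \text{for all}\ \{i,j\}\in\mathcal E\right\}.$$ -/

import Mathlib

open Set Filter Topology MeasureTheory

noncomputable section

namespace NonlinearConsensus

/-- The linear subspace `⟨1⟩^⊥` of Euclidean space `ℝⁿ`, orthogonal to the all-ones vector. -/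
def onesPerp (n : ℕ) : Submodule ℝ (EuclideanSpace ℝ (Fin n)) :=
  (Submodule.span ℝ {WithLp.toLp 2 (fun _ : Fin n => (1 : ℝ))})ᗮ

/-- Lebesgue measure on the Euclidean space `⟨1⟩^⊥`: the Haar measure which gives mass one to the
unit cube of an orthonormal basis. (It is written out because the instance found for `volume` on a
subspace may be the restriction of the ambient Lebesgue measure, which is zero here.) -/
def lebesgueOnesPerp (n : ℕ) : Measure (onesPerp n) :=
  (stdOrthonormalBasis ℝ (onesPerp n)).toBasis.addHaar

/-- The vector field `x ↦ (∑_{j ∼ i} f_{ij}(x_i - x_j))_i` of nonlinear consensus dynamics on the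
graph `G`, with one coupling function for each unordered pair of nodes (only the values of `f` on
edges of `G` are used). -/
def consensusField {n : ℕ} (G : SimpleGraph (Fin n)) [DecidableRel G.Adj]
    (f : Sym2 (Fin n) → ℝ → ℝ) (x : EuclideanSpace ℝ (Fin n)) : EuclideanSpace ℝ (Fin n) :=
  WithLp.toLp 2 (fun i => ∑ j ∈ G.neighborFinset i, f s(i, j) (x i - x j))

section Dynamics

variable {E : Type*} [NormedAddCommGroup E] [NormedSpace ℝ E]

/-- The time interval `[0, T)`, where `T` may be `+∞`. -/
def forwardInterval (T : EReal) : Set ℝ := {t : ℝ | 0 ≤ t ∧ (t : EReal) < T}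

/-- `γ` solves `γ' = g(γ)` on `[0, T)`, with `0 < T ≤ +∞`
(the derivative at time `0` is one-sided). -/
def IsForwardSolution (g : E → E) (T : EReal) (γ : ℝ → E) : Prop :=
  0 < T ∧ IsIntegralCurveOn γ (fun _ => g) (forwardInterval T)

/-- `γ` on `[0, T)` is a forward solution of `γ' = g(γ)` whose interval of existence is maximal:
no forward solution with the same initial value exists for longer. -/
def IsMaximalForwardSolution (g : E → E) (T : EReal) (γ : ℝ → E) : Prop :=
  IsForwardSolution g T γ ∧
    ∀ (S : EReal) (η : ℝ → E), IsForwardSolution g S η → η 0 = γ 0 → S ≤ T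

/-- `p` is a (Lyapunov) stable equilibrium of `x' = g(x)` in the invariant set `K`: solutions that
start in `K` close enough to `p` exist and remain close to `p` for all positive times. -/
def IsStableEquilibriumIn (g : E → E) (K : Set E) (p : E) : Prop :=
  p ∈ K ∧ g p = 0 ∧
    ∀ ε > 0, ∃ δ > 0, ∀ (T : EReal) (γ : ℝ → E), IsMaximalForwardSolution g T γ →
      γ 0 ∈ K → dist (γ 0) p < δ → T = ⊤ ∧ ∀ t : ℝ, 0 ≤ t → dist (γ t) p < ε

end Dynamics

end NonlinearConsensus

end

namespace NonlinearConsensus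

open Metric

/-! ### Existence, uniqueness and continuation of forward solutions -/

section ForwardSolutions

variable {E : Type*} [NormedAddCommGroup E] [NormedSpace ℝ E] {g : E → E}

/-! The field is a gradient, so `consensusPotential` increases along orbits at rate ‖g‖². A bounded
maximal orbit is therefore global, and its cluster points are equilibria.

The tree enters through cuts. Deleting an edge splits the graph, and pairing an antisymmetric flow
with the indicator of one side isolates that edge, so a divergence-free flow vanishes
(`eq_zero_of_sum_neighborFinset_eq_zero`). Hence equilibria are edgewise roots. By simplicity of the
roots and connectedness, the linearization, a weighted Laplacian, is injective on ⟨1⟩^⊥. Equilibria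
there are thus isolated and countable, and bounded orbits converge.

If all edge derivatives at `p` are negative, the field does not point away from `p` nearby, which
gives stability. If one is positive, its cut vector makes the quadratic form `q` of the
linearization positive.

No stable manifold is constructed. By `inner_nonpos_of_bounded`, two orbits that stay near `p`
forever start at points whose difference satisfies `q ≤ 0`, since otherwise `q` of the difference
would grow exponentially. This shows instability when one orbit is the constant `p`. It also shows
that the set of starting points of such orbits is null, having infinitely many disjoint translates
in a bounded region. Backward Gronwall estimates carry nullity to the whole bounded basin of `p`,
and a countable union over equilibria finishes the proof. -/

theorem mem_forwardInterval {T : EReal} {t : ℝ} :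
    t ∈ forwardInterval T ↔ 0 ≤ t ∧ (t : EReal) < T := Iff.rfl

theorem zero_mem_forwardInterval {T : EReal} (hT : 0 < T) : (0 : ℝ) ∈ forwardInterval T :=
  ⟨le_rfl, by simpa using hT⟩

theorem forwardInterval_top : forwardInterval ⊤ = Ici 0 := by
  ext t; simp [mem_forwardInterval, EReal.coe_lt_top]

theorem forwardInterval_coe (T : ℝ) : forwardInterval T = Ico 0 T := by
  ext t; simp [mem_forwardInterval]

theorem Icc_subset_forwardInterval {T : EReal} {t : ℝ} (ht : t ∈ forwardInterval T) :
    Icc 0 t ⊆ forwardInterval T :=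
  fun _ hs => ⟨hs.1, lt_of_le_of_lt (EReal.coe_le_coe_iff.2 hs.2) ht.2⟩

theorem forwardInterval_mem_nhdsWithin_Ici {T : EReal} {t : ℝ} (ht : t ∈ forwardInterval T) :
    forwardInterval T ∈ 𝓝[Ici t] t := by
  have h : {s : ℝ | (s : EReal) < T} ∈ 𝓝 t :=
    (isOpen_lt continuous_coe_real_ereal continuous_const).mem_nhds ht.2
  filter_upwards [mem_nhdsWithin_of_mem_nhds h, self_mem_nhdsWithin] with s hs hts
  exact ⟨ht.1.trans hts, hs⟩

theorem forwardInterval_mem_nhds {T : EReal} {t : ℝ} (ht : t ∈ forwardInterval T) (h0 : 0 < t) :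
    forwardInterval T ∈ 𝓝 t := by
  have h : {s : ℝ | (s : EReal) < T} ∈ 𝓝 t :=
    (isOpen_lt continuous_coe_real_ereal continuous_const).mem_nhds ht.2
  filter_upwards [h, Ioi_mem_nhds h0] with s hs hts
  exact ⟨le_of_lt hts, hs⟩

theorem forwardInterval_mem_nhdsWithin {S T : EReal} {t : ℝ} (ht : t ∈ forwardInterval S) :
    forwardInterval S ∈ 𝓝[forwardInterval T] t := by
  have h : {s : ℝ | (s : EReal) < S} ∈ 𝓝 t :=
    (isOpen_lt continuous_coe_real_ereal continuous_const).mem_nhds ht.2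
  filter_upwards [mem_nhdsWithin_of_mem_nhds h, self_mem_nhdsWithin] with s hs hts
  exact ⟨hts.1, hs⟩

theorem IsForwardSolution.hasDerivWithinAt_Ici {T : EReal} {γ : ℝ → E}
    (h : IsForwardSolution g T γ) {t : ℝ} (ht : t ∈ forwardInterval T) :
    HasDerivWithinAt γ (g (γ t)) (Ici t) t :=
  (h.2 t ht).mono_of_mem_nhdsWithin (forwardInterval_mem_nhdsWithin_Ici ht)

theorem IsForwardSolution.hasDerivAt {T : EReal} {γ : ℝ → E}
    (h : IsForwardSolution g T γ) {t : ℝ} (ht : t ∈ forwardInterval T) (h0 : 0 < t) :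
    HasDerivAt γ (g (γ t)) t :=
  (h.2 t ht).hasDerivAt (forwardInterval_mem_nhds ht h0)

theorem IsForwardSolution.continuousOn {T : EReal} {γ : ℝ → E}
    (h : IsForwardSolution g T γ) : ContinuousOn γ (forwardInterval T) :=
  IsIntegralCurveOn.continuousOn h.2

theorem exists_lipschitzOnWith_closedBall [FiniteDimensional ℝ E] (hg : ContDiff ℝ 1 g) (R : ℝ) :
    ∃ K, LipschitzOnWith K g (closedBall 0 R) :=
  (hg.locallyLipschitz.locallyLipschitzOn).exists_lipschitzOnWith_of_compact
    (isCompact_closedBall 0 R)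

/-- Solutions starting in a given ball exist for a time that depends only on the ball. -/
theorem exists_uniform_time [FiniteDimensional ℝ E] (hg : ContDiff ℝ 1 g) (R : ℝ) :
    ∃ τ > 0, ∀ x ∈ closedBall (0 : E) R, ∀ t₀ : ℝ, ∃ η : ℝ → E, η t₀ = x ∧
      ∀ t ∈ Ioo (t₀ - τ) (t₀ + τ), HasDerivAt η (g (η t)) t := by
  obtain hR | hR := lt_or_ge R 0
  · exact ⟨1, one_pos, fun x hx => by simp [closedBall_eq_empty.2 hR] at hx⟩
  lift R to NNReal using hR
  obtain ⟨K, hK⟩ := exists_lipschitzOnWith_closedBall hg ((R + 1 : NNReal) : ℝ)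
  obtain ⟨M, hM⟩ := (isCompact_closedBall (0 : E) ((R + 1 : NNReal) : ℝ)).exists_bound_of_continuousOn
    hg.continuous.continuousOn
  have hτ : 0 < 1 / (M.toNNReal + 1 : ℝ) := by positivity
  -- At speed at most `M`, a solution starting in the ball of radius `R` travels less than 1 in this
  -- time, so it stays in the ball of radius `R + 1`, where the bounds hold.
  refine ⟨1 / (M.toNNReal + 1 : ℝ), hτ, fun x hx t₀ => ?_⟩
  set τ := 1 / (M.toNNReal + 1 : ℝ)
  have hP : IsPicardLindelof (fun _ => g) (tmin := t₀ - τ) (tmax := t₀ + τ)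
      ⟨t₀, by constructor <;> linarith⟩ 0 (R + 1) R M.toNNReal K := by
    refine IsPicardLindelof.of_time_independent
      (fun y hy => (hM y hy).trans (Real.le_coe_toNNReal M)) hK ?_
    simp only [add_sub_cancel_left, sub_sub_cancel, max_self, NNReal.coe_add, NNReal.coe_one]
    rw [mul_one_div, div_le_one (by positivity)]
    linarith
  obtain ⟨η, h0, hη⟩ := hP.exists_eq_forall_mem_Icc_hasDerivWithinAt hx
  exact ⟨η, h0, fun t ht => (hη t (Ioo_subset_Icc_self ht)).hasDerivAt (Icc_mem_nhds ht.1 ht.2)⟩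

theorem exists_isForwardSolution [FiniteDimensional ℝ E] (hg : ContDiff ℝ 1 g) (x : E) :
    ∃ (T : EReal) (γ : ℝ → E), IsForwardSolution g T γ ∧ γ 0 = x := by
  obtain ⟨τ, hτ, h⟩ := exists_uniform_time hg ‖x‖
  obtain ⟨η, h0, hη⟩ := h x (by simp) 0
  refine ⟨(τ : EReal), η, ⟨by exact_mod_cast hτ, fun t ht => ?_⟩, h0⟩
  rw [forwardInterval_coe] at ht
  exact (hη t ⟨by linarith [ht.1], by linarith [ht.2]⟩).hasDerivWithinAt

theorem IsForwardSolution.eq_of_zero_eq [FiniteDimensional ℝ E] (hg : ContDiff ℝ 1 g)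
    {S T : EReal} {γ η : ℝ → E} (hγ : IsForwardSolution g S γ) (hη : IsForwardSolution g T η)
    (h0 : γ 0 = η 0) {t : ℝ} (hS : t ∈ forwardInterval S) (hT : t ∈ forwardInterval T) :
    γ t = η t := by
  have hcS := hγ.continuousOn.mono (Icc_subset_forwardInterval hS)
  have hcT := hη.continuousOn.mono (Icc_subset_forwardInterval hT)
  obtain ⟨R, hR⟩ := isCompact_Icc.exists_bound_of_continuousOn hcS
  obtain ⟨R', hR'⟩ := isCompact_Icc.exists_bound_of_continuousOn hcT
  obtain ⟨K, hK⟩ := exists_lipschitzOnWith_closedBall hg (max R R')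
  refine ODE_solution_unique_of_mem_Icc_right (v := fun _ => g) (K := K)
    (s := fun _ => closedBall 0 (max R R')) (fun _ _ => hK) hcS
    (fun s hs => hγ.hasDerivWithinAt_Ici (Icc_subset_forwardInterval hS ⟨hs.1, hs.2.le⟩))
    (fun s hs => ?_) hcT
    (fun s hs => hη.hasDerivWithinAt_Ici (Icc_subset_forwardInterval hT ⟨hs.1, hs.2.le⟩))
    (fun s hs => ?_) h0 ⟨hS.1, le_rfl⟩
  · exact mem_closedBall_zero_iff.2 ((hR s ⟨hs.1, hs.2.le⟩).trans (le_max_left _ _))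
  · exact mem_closedBall_zero_iff.2 ((hR' s ⟨hs.1, hs.2.le⟩).trans (le_max_right _ _))

/-- The maximal time is the supremum of all existence times. A solution is chosen for each `t`, and
uniqueness makes the diagonal `η t t` agree locally with a single one of them. -/
theorem exists_isMaximalForwardSolution [FiniteDimensional ℝ E] (hg : ContDiff ℝ 1 g) (x : E) :
    ∃ (T : EReal) (γ : ℝ → E), IsMaximalForwardSolution g T γ ∧ γ 0 = x := by
  classical
  set 𝒮 : Set EReal := {S | ∃ η, IsForwardSolution g S η ∧ η 0 = x} with h𝒮
  have hex : ∀ t ∈ forwardInterval (sSup 𝒮), ∃ S η, IsForwardSolution g S η ∧ η 0 = x ∧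
      t ∈ forwardInterval S := by
    intro t ht
    obtain ⟨S, ⟨η, hη, h0⟩, hS⟩ := lt_sSup_iff.1 ht.2
    exact ⟨S, η, hη, h0, ht.1, hS⟩
  choose! S η hη h0 hS using hex
  obtain ⟨S₀, η₀, hη₀, hx₀⟩ := exists_isForwardSolution hg x
  have hpos : 0 < sSup 𝒮 := hη₀.1.trans_le (le_sSup ⟨η₀, hη₀, hx₀⟩)
  have hz := zero_mem_forwardInterval hpos
  have heq : ∀ t ∈ forwardInterval (sSup 𝒮), ∀ s ∈ forwardInterval (sSup 𝒮),
      s ∈ forwardInterval (S t) → η s s = η t s := fun t ht s hs hst =>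
    (hη s hs).eq_of_zero_eq hg (hη t ht) ((h0 s hs).trans (h0 t ht).symm) (hS s hs) hst
  refine ⟨sSup 𝒮, fun t => η t t, ⟨⟨hpos, fun t ht => ?_⟩, fun S' η' hη' h' => ?_⟩, h0 0 hz⟩
  · have hd := ((hη t ht).2 t (hS t ht)).mono_of_mem_nhdsWithin
      (forwardInterval_mem_nhdsWithin (T := sSup 𝒮) (hS t ht))
    refine hd.congr_of_eventuallyEq ?_ rfl
    filter_upwards [forwardInterval_mem_nhdsWithin (T := sSup 𝒮) (hS t ht),
      self_mem_nhdsWithin] with s hs hs'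
    exact heq t ht s hs' hs
  · exact le_sSup ⟨η', hη', h'.trans (h0 0 hz)⟩

/-- Blow-up alternative: the restart time depends only on the bound `R`, so restarting close enough
to a finite `T` would continue the solution past `T`. -/
theorem IsMaximalForwardSolution.eq_top_of_bounded [FiniteDimensional ℝ E]
    (hg : ContDiff ℝ 1 g) {T : EReal} {γ : ℝ → E} (h : IsMaximalForwardSolution g T γ) {R : ℝ}
    (hR : ∀ t ∈ forwardInterval T, ‖γ t‖ ≤ R) : T = ⊤ := by
  obtain ⟨hγ, hmax⟩ := h
  by_contra hT
  lift T to ℝ using ⟨hT, (lt_trans (EReal.bot_lt_zero) hγ.1).ne'⟩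
  have hT0 : 0 < T := by exact_mod_cast hγ.1
  obtain ⟨τ, hτ, hloc⟩ := exists_uniform_time hg R
  -- Less than `τ` before `T`, and positive so that `γ` has a two-sided derivative at `t₀`.
  set t₀ := max (T / 2) (T - τ / 2)
  have ht₀ : 0 < t₀ := lt_max_of_lt_left (by linarith)
  have ht₀T : t₀ < T := max_lt (by linarith) (by linarith)
  have ht₀τ : T < t₀ + τ := by linarith [le_max_right (T / 2) (T - τ / 2)]
  have hmem : t₀ ∈ forwardInterval T := by
    rw [forwardInterval_coe]; exact ⟨ht₀.le, ht₀T⟩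
  obtain ⟨η, hη0, hη⟩ := hloc (γ t₀) (mem_closedBall_zero_iff.2 (hR t₀ hmem)) t₀
  have hle := hmax ((t₀ + τ : ℝ) : EReal) (fun t => if t ≤ t₀ then γ t else η t)
    ⟨by exact_mod_cast (by linarith), fun t ht => ?_⟩ (by simp [ht₀.le])
  · rw [EReal.coe_le_coe_iff] at hle; linarith
  rw [forwardInterval_coe] at ht
  rcases lt_trichotomy t t₀ with hlt | rfl | hgt
  · have hd := (hγ.2 t ⟨ht.1, EReal.coe_lt_coe_iff.2 (hlt.trans ht₀T)⟩).mono_of_mem_nhdsWithin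
      (forwardInterval_mem_nhdsWithin (T := ((t₀ + τ : ℝ) : EReal))
        ⟨ht.1, EReal.coe_lt_coe_iff.2 (hlt.trans ht₀T)⟩)
    simp only [hlt.le, if_true]
    refine hd.congr_of_eventuallyEq ?_ (by simp [hlt.le])
    filter_upwards [mem_nhdsWithin_of_mem_nhds (Iio_mem_nhds hlt)] with s hs
    simp [le_of_lt (mem_Iio.1 hs)]
  · have h1 := (hγ.hasDerivAt hmem ht₀).hasDerivWithinAt (s := Iic t₀)
    have h2 := (hη t₀ ⟨by linarith, by linarith⟩).hasDerivWithinAt (s := Ici t₀)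
    rw [hη0] at h2
    have h1' : HasDerivWithinAt (fun t => if t ≤ t₀ then γ t else η t) (g (γ t₀)) (Iic t₀) t₀ :=
      h1.congr (fun s hs => by simp [mem_Iic.1 hs]) (by simp)
    have h2' : HasDerivWithinAt (fun t => if t ≤ t₀ then γ t else η t) (g (γ t₀)) (Ici t₀) t₀ := by
      refine h2.congr (fun s hs => ?_) (by simp [hη0])
      rcases (mem_Ici.1 hs).eq_or_lt with rfl | hs
      · simp [hη0]
      · simp [not_le.2 hs]
    have h3 := h1'.union h2'
    simp only [le_refl, if_true]
    exact h3.mono (by rw [Iic_union_Ici]; exact subset_univ _)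
  · simp only [not_le.2 hgt, if_false]
    have hd := hη t ⟨by linarith, ht.2⟩
    refine (hd.congr_of_eventuallyEq ?_).hasDerivWithinAt
    filter_upwards [Ioi_mem_nhds hgt] with s hs
    simp [not_le.2 (mem_Ioi.1 hs)]

theorem IsForwardSolution.apply_eq_of_comp_eq_zero (ℓ : E →L[ℝ] ℝ) (hℓ : ∀ x, ℓ (g x) = 0)
    {T : EReal} {γ : ℝ → E} (h : IsForwardSolution g T γ) {t : ℝ} (ht : t ∈ forwardInterval T) :
    ℓ (γ t) = ℓ (γ 0) := by
  have hsub := Icc_subset_forwardInterval ht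
  refine constant_of_has_deriv_right_zero (f := fun s => ℓ (γ s))
    (ℓ.continuous.comp_continuousOn (h.continuousOn.mono hsub)) (fun s hs => ?_) t ⟨ht.1, le_rfl⟩
  have := ℓ.hasFDerivAt.comp_hasDerivWithinAt s (h.hasDerivWithinAt_Ici (hsub ⟨hs.1, hs.2.le⟩))
  rwa [hℓ] at this

/-- Solutions of a Lipschitz equation cannot approach each other faster than exponentially. -/
theorem dist_zero_le_of_lipschitzOnWith {K : NNReal} {s : Set E} (hK : LipschitzOnWith K g s)
    {γ η : ℝ → E} (hγ : IsForwardSolution g ⊤ γ) (hη : IsForwardSolution g ⊤ η)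
    (hγs : ∀ t, 0 ≤ t → γ t ∈ s) (hηs : ∀ t, 0 ≤ t → η t ∈ s) {t : ℝ} (ht : 0 ≤ t) :
    dist (γ 0) (η 0) ≤ dist (γ t) (η t) * Real.exp (K * t) := by
  -- Reversing time on `[0, t]` turns solutions of `g` into solutions of `-g`, to which the forward
  -- Gronwall estimate applies.
  have hrev : ∀ {γ : ℝ → E}, IsForwardSolution g ⊤ γ →
      ContinuousOn (fun u => γ (t - u)) (Icc 0 t) ∧ ∀ u ∈ Ico 0 t,
        HasDerivWithinAt (fun u => γ (t - u)) (-g (γ (t - u))) (Ici u) u := by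
    intro γ hγ
    refine ⟨?_, fun u hu => ?_⟩
    · refine hγ.continuousOn.comp (by fun_prop) fun u hu => ?_
      rw [forwardInterval_top]
      exact sub_nonneg.2 hu.2
    · have hd := hγ.hasDerivAt (t := t - u)
        (by rw [forwardInterval_top]; exact sub_nonneg.2 hu.2.le) (sub_pos.2 hu.2)
      have h2 : HasDerivAt (fun u : ℝ => t - u) (-1) u := by
        simpa using (hasDerivAt_id u).const_sub t
      have h3 := hd.scomp u h2
      rw [neg_one_smul] at h3
      exact h3.hasDerivWithinAt
  have hK' : LipschitzOnWith K (fun x => -g x) s := by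
    intro x hx y hy
    simpa [edist_neg_neg] using hK hx hy
  have := dist_le_of_trajectories_ODE_of_mem (v := fun _ x => -g x) (s := fun _ => s)
    (fun _ _ => hK') (hrev hγ).1 (hrev hγ).2 (fun u hu => hγs _ (sub_nonneg.2 hu.2.le))
    (hrev hη).1 (hrev hη).2 (fun u hu => hηs _ (sub_nonneg.2 hu.2.le)) le_rfl t ⟨ht, le_rfl⟩
  simpa using this

end ForwardSolutions

/-! ### Cone estimate for differences of orbits -/

section Dichotomy

variable {E : Type*} [NormedAddCommGroup E] [InnerProductSpace ℝ E]

/-- A bounded curve with `d' ≈ L d`, where `L` is symmetric and bounded below along the curve,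
starts in the cone where the quadratic form of `L` is nonpositive. -/
theorem inner_nonpos_of_bounded {L : E →L[ℝ] E} (hL : (L : E →ₗ[ℝ] E).IsSymmetric) {c B : ℝ}
    (hc : 0 < c) {d d' : ℝ → E} (hcont : ContinuousOn d (Ici 0))
    (hd : ∀ t, 0 ≤ t → HasDerivWithinAt d (d' t) (Ici t) t)
    (hlow : ∀ t, 0 ≤ t → c * ‖d t‖ ≤ ‖L (d t)‖)
    (herr : ∀ t, 0 ≤ t → ‖d' t - L (d t)‖ ≤ c / 2 * ‖d t‖)
    (hB : ∀ t, 0 ≤ t → ‖d t‖ ≤ B) : inner ℝ (L (d 0)) (d 0) ≤ 0 := by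
  set q : ℝ → ℝ := fun t => inner ℝ (L (d t)) (d t)
  -- Growth rate of `q`: the error is at most half of ‖L d‖, so `q' ≥ ‖L d‖² ≥ c² ‖d‖² ≥ κ q`. The
  -- `+ 1` avoids dividing by zero.
  set κ : ℝ := c ^ 2 / (‖L‖ + 1)
  have hLpos : 0 < ‖L‖ + 1 := by positivity
  have hκ : 0 < κ := by positivity
  have hqle : ∀ t, q t ≤ (‖L‖ + 1) * ‖d t‖ ^ 2 := fun t =>
    calc q t ≤ ‖L (d t)‖ * ‖d t‖ := real_inner_le_norm _ _
      _ ≤ (‖L‖ * ‖d t‖) * ‖d t‖ := by gcongr; exact L.le_opNorm _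
      _ ≤ (‖L‖ + 1) * ‖d t‖ ^ 2 := by nlinarith [sq_nonneg ‖d t‖]
  have hqd : ∀ t, 0 ≤ t → HasDerivWithinAt q (2 * inner ℝ (L (d t)) (d' t)) (Ici t) t := by
    intro t ht
    have h := (L.hasFDerivAt.comp_hasDerivWithinAt t (hd t ht)).inner ℝ (hd t ht)
    refine h.congr_deriv ?_
    have h2 := hL (d' t) (d t)
    simp only [ContinuousLinearMap.coe_coe] at h2
    rw [h2, real_inner_comm (L (d t)) (d' t)]
    simp only [Function.comp]
    ring
  have hqd' : ∀ t, 0 ≤ t → κ * q t ≤ 2 * inner ℝ (L (d t)) (d' t) := by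
    intro t ht
    have h1 : inner ℝ (L (d t)) (d' t) = ‖L (d t)‖ ^ 2 + inner ℝ (L (d t)) (d' t - L (d t)) := by
      rw [inner_sub_right, real_inner_self_eq_norm_sq]; ring
    have h2 := neg_le_of_abs_le (abs_real_inner_le_norm (L (d t)) (d' t - L (d t)))
    have h3 : ‖L (d t)‖ * ‖d' t - L (d t)‖ ≤ ‖L (d t)‖ * (‖L (d t)‖ / 2) := by
      gcongr
      linarith [herr t ht, hlow t ht]
    have h4 : (c * ‖d t‖) ^ 2 ≤ ‖L (d t)‖ ^ 2 :=
      pow_le_pow_left₀ (by positivity) (hlow t ht) 2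
    have h5 : κ * q t ≤ (c * ‖d t‖) ^ 2 :=
      calc κ * q t ≤ κ * ((‖L‖ + 1) * ‖d t‖ ^ 2) := by gcongr; exact hqle t
        _ = (c * ‖d t‖) ^ 2 := by simp only [κ]; field_simp
    nlinarith
  have hmono : ∀ t, 0 ≤ t → q 0 ≤ q t * Real.exp (-κ * t) := by
    intro t ht
    have hexp : ∀ s : ℝ, HasDerivAt (fun s => Real.exp (-κ * s)) (Real.exp (-κ * s) * (-κ)) s :=
      fun s => by simpa using ((hasDerivAt_id s).const_mul (-κ)).exp
    have h := image_le_of_deriv_right_le_deriv_boundary (a := 0) (b := t)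
      (f := fun s => -(q s * Real.exp (-κ * s)))
      (f' := fun s => -(2 * inner ℝ (L (d s)) (d' s) * Real.exp (-κ * s) +
        q s * (Real.exp (-κ * s) * (-κ))))
      (B := fun _ => -q 0) (B' := fun _ => 0) ?_ ?_ (by simp) continuousOn_const
      (fun s _ => hasDerivWithinAt_const _ _ _) ?_ (right_mem_Icc.2 ht)
    · simpa using h
    · have hcd : ContinuousOn d (Icc 0 t) := hcont.mono Icc_subset_Ici_self
      exact (((L.continuous.comp_continuousOn hcd).inner hcd).mul (by fun_prop)).neg
    · exact fun s hs => ((hqd s hs.1).mul (hexp s).hasDerivWithinAt).neg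
    · intro s hs
      have := mul_le_mul_of_nonneg_right (hqd' s hs.1) (Real.exp_pos (-κ * s)).le
      linarith
  have hlim : Tendsto (fun t : ℝ => ((‖L‖ + 1) * B ^ 2) * Real.exp (-κ * t)) atTop (𝓝 0) := by
    have h1 : Tendsto (fun t : ℝ => -κ * t) atTop atBot :=
      tendsto_id.const_mul_atTop_of_neg (neg_lt_zero.2 hκ)
    simpa using (Real.tendsto_exp_atBot.comp h1).const_mul ((‖L‖ + 1) * B ^ 2)
  refine ge_of_tendsto hlim ?_
  filter_upwards [eventually_ge_atTop 0] with t ht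
  refine (hmono t ht).trans ?_
  gcongr
  refine (hqle t).trans ?_
  gcongr
  exact hB t ht

end Dichotomy

/-! ### Two criteria for null sets -/

section NullSets

variable {V : Type*} [NormedAddCommGroup V] [InnerProductSpace ℝ V] [FiniteDimensional ℝ V]
  [MeasurableSpace V] [BorelSpace V]

/-- A set whose differences avoid a cone with nonempty interior is null. -/
theorem measure_eq_zero_of_quadratic_nonpos (μ : Measure V) [μ.IsAddHaarMeasure] {q : V → ℝ}
    (hq : Continuous q) (hsmul : ∀ (s : ℝ) v, q (s • v) = s ^ 2 * q v) {v : V} (hv : 0 < q v)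
    {W : Set V} (hW : ∀ x ∈ W, ∀ y ∈ W, q (x - y) ≤ 0) : μ W = 0 := by
  -- The condition is closed, so it passes to the closure, which is measurable.
  have hcl : ∀ x ∈ closure W, ∀ y ∈ closure W, q (x - y) ≤ 0 := by
    have h : closure W ×ˢ closure W ⊆ {z : V × V | q (z.1 - z.2) ≤ 0} := by
      rw [← closure_prod_eq]
      exact closure_minimal (fun z hz => hW _ hz.1 _ hz.2)
        (isClosed_le (hq.comp (by fun_prop)) continuous_const)
    exact fun x hx y hy => h (mk_mem_prod hx hy)
  refine measure_mono_null subset_closure ?_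
  have hinj : ∀ m n : ℕ, m ≠ n → ((1 / 2 : ℝ) ^ m - (1 / 2) ^ n) ≠ 0 := fun m n hmn h =>
    hmn (pow_right_injective₀ (by norm_num) (by norm_num) (sub_eq_zero.1 h))
  -- The translations `2⁻ⁿ v` are bounded. If two translates met, some nonzero multiple of `v` would
  -- be a difference of points of the closure, where `q ≤ 0`.
  refine Measure.addHaar_eq_zero_of_disjoint_translates μ (fun n : ℕ => ((1 / 2 : ℝ) ^ n) • v) ?_
    ?_ isClosed_closure.measurableSet
  · refine (isBounded_closedBall (x := (0 : V)) (r := ‖v‖)).subset ?_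
    rintro _ ⟨n, rfl⟩
    rw [mem_closedBall_zero_iff, norm_smul, Real.norm_of_nonneg (by positivity)]
    exact mul_le_of_le_one_left (norm_nonneg _) (pow_le_one₀ (by norm_num) (by norm_num))
  · intro m n hmn
    simp only [Function.onFun, disjoint_left, singleton_add, mem_image]
    rintro _ ⟨x, hx, rfl⟩ ⟨y, hy, hxy⟩
    have h1 : y - x = ((1 / 2 : ℝ) ^ m - (1 / 2) ^ n) • v := by
      rw [sub_smul, sub_eq_sub_iff_add_eq_add, add_comm y, hxy]
    have h2 := hcl y hy x hx
    rw [h1, hsmul] at h2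
    have := pow_pos (abs_pos.2 (hinj m n hmn)) 2
    rw [sq_abs] at this
    nlinarith

/-- A set mapped expansively (up to a constant) into a null set is null. -/
theorem measure_eq_zero_of_dist_le (μ : Measure V) [μ.IsAddHaarMeasure] {A W : Set V} {φ : V → V}
    (hφ : MapsTo φ A W) {C : NNReal} (hC : ∀ x ∈ A, ∀ y ∈ A, dist x y ≤ C * dist (φ x) (φ y))
    (hW : μ W = 0) : μ A = 0 := by
  have hinj : InjOn φ A := fun x hx y hy h => by
    simpa [h, dist_le_zero] using hC x hx y hy
  have hLip : LipschitzOnWith C (Function.invFunOn φ A) (φ '' A) := by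
    refine LipschitzOnWith.of_dist_le_mul ?_
    rintro _ ⟨x, hx, rfl⟩ _ ⟨y, hy, rfl⟩
    rw [hinj.leftInvOn_invFunOn hx, hinj.leftInvOn_invFunOn hy]
    exact hC x hx y hy
  have hA : Function.invFunOn φ A '' (φ '' A) = A := hinj.invFunOn_image subset_rfl
  -- Hausdorff measure of full dimension is a Haar measure and is controlled under the Lipschitz
  -- inverse, which is defined only on `φ '' A`; no measurability of `A` is needed.
  refine Measure.absolutelyContinuous_isAddHaarMeasure μ
    (μH[(Module.finrank ℝ V : ℝ)] : Measure V) ?_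
  have hW' : (μH[(Module.finrank ℝ V : ℝ)] : Measure V) (φ '' A) = 0 :=
    measure_mono_null hφ.image_subset
      (Measure.absolutelyContinuous_isAddHaarMeasure (μH[(Module.finrank ℝ V : ℝ)]) μ hW)
  have := hLip.hausdorffMeasure_image_le (d := Module.finrank ℝ V) (by positivity)
  rw [hA, hW', mul_zero] at this
  exact le_antisymm this zero_le

end NullSets

/-! ### Stability from an inward-pointing field -/

section Stability

variable {E : Type*} [NormedAddCommGroup E] [InnerProductSpace ℝ E] {g : E → E}

/-- If `g` points towards `p` on a ball around `p`, maximal solutions starting in the ball are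
global and do not move away from `p`. -/
theorem IsMaximalForwardSolution.dist_le [FiniteDimensional ℝ E] (hg : ContDiff ℝ 1 g) {p : E}
    {r : ℝ} (hin : ∀ x ∈ ball p r, inner ℝ (x - p) (g x) ≤ 0) {T : EReal} {γ : ℝ → E}
    (hγ : IsMaximalForwardSolution g T γ) (h0 : dist (γ 0) p < r) :
    T = ⊤ ∧ ∀ t, 0 ≤ t → dist (γ t) p ≤ dist (γ 0) p := by
  have hmain : ∀ t ∈ forwardInterval T, dist (γ t) p ≤ dist (γ 0) p := by
    intro t ht
    have hsub := Icc_subset_forwardInterval ht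
    refine le_of_forall_gt_imp_ge_of_dense fun ρ hρ => ?_
    wlog hρr : ρ < r generalizing ρ
    · obtain ⟨ρ', h1, h2⟩ := exists_between h0
      exact (this ρ' h1 h2).trans (h2.le.trans (not_lt.1 hρr))
    have hρ0 : 0 < ρ := dist_nonneg.trans_lt hρ
    -- The slope of a strict barrier for the squared distance, small enough that the barrier stays
    -- below `ρ² < r²`; at a contact point the orbit is then still in the ball where `hin` applies.
    set η : ℝ := (ρ ^ 2 - dist (γ 0) p ^ 2) / (t + 1)
    have hnum : 0 < ρ ^ 2 - dist (γ 0) p ^ 2 := by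
      have := pow_lt_pow_left₀ hρ dist_nonneg two_ne_zero
      linarith
    have hη : 0 < η := div_pos hnum (by linarith [ht.1])
    have hηt : ∀ s ∈ Icc 0 t, dist (γ 0) p ^ 2 + η * s ≤ ρ ^ 2 := by
      intro s hs
      have h1 : η * s ≤ η * (t + 1) := by gcongr; linarith [hs.2]
      have h2 : η * (t + 1) = ρ ^ 2 - dist (γ 0) p ^ 2 :=
        div_mul_cancel₀ _ (by linarith [ht.1])
      linarith
    have h := image_le_of_deriv_right_lt_deriv_boundary' (a := 0) (b := t)
      (f := fun s => ‖γ s - p‖ ^ 2) (f' := fun s => 2 * inner ℝ (γ s - p) (g (γ s)))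
      (B := fun s => dist (γ 0) p ^ 2 + η * s) (B' := fun _ => η) ?_ ?_ ?_ ?_ ?_ ?_
      (right_mem_Icc.2 ht.1)
    · have h2 := h.trans (hηt t (right_mem_Icc.2 ht.1))
      rw [dist_eq_norm]
      exact le_of_sq_le_sq h2 hρ0.le
    · exact ((hγ.1.continuousOn.mono hsub).sub continuousOn_const).norm.pow 2
    · intro s hs
      exact ((hγ.1.hasDerivWithinAt_Ici (hsub ⟨hs.1, hs.2.le⟩)).sub_const p).norm_sq
    · simp [dist_eq_norm]
    · fun_prop
    · intro s _
      simpa using (((hasDerivAt_id s).const_mul η).const_add (dist (γ 0) p ^ 2)).hasDerivWithinAt (s := Ici s)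
    · intro s hs heq
      refine lt_of_le_of_lt ?_ hη
      have hle : ‖γ s - p‖ ^ 2 ≤ ρ ^ 2 := heq.trans_le (hηt s ⟨hs.1, hs.2.le⟩)
      have := hin (γ s) (by
        rw [mem_ball, dist_eq_norm]
        exact (le_of_sq_le_sq hle hρ0.le).trans_lt hρr)
      linarith
  have hT : T = ⊤ := hγ.eq_top_of_bounded hg (R := dist (γ 0) p + ‖p‖) fun t ht => by
    have h1 := hmain t ht
    rw [dist_eq_norm (γ t)] at h1
    linarith [norm_le_norm_sub_add (γ t) p]
  refine ⟨hT, fun t ht => hmain t ?_⟩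
  rw [hT, forwardInterval_top]
  exact ht

end Stability

/-! ### Convergence of bounded gradient-like orbits -/

section Convergence

variable {E : Type*} [NormedAddCommGroup E] [NormedSpace ℝ E] [ProperSpace E] {g : E → E}
  {Φ : E → ℝ} {γ : ℝ → E} {R : ℝ}

/-- If `g q ≠ 0`, each visit close to `q` raises `Φ` by a fixed amount over a fixed time, whereas
`Φ` is monotone and bounded along the orbit. -/
theorem IsForwardSolution.apply_mapClusterPt_eq_zero (hg : Continuous g) (hΦ : Continuous Φ)
    (hγ : IsForwardSolution g ⊤ γ) (hR : ∀ t, 0 ≤ t → ‖γ t‖ ≤ R)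
    (hΦγ : ∀ t, 0 ≤ t → HasDerivWithinAt (fun s => Φ (γ s)) (‖g (γ t)‖ ^ 2) (Ici t) t)
    {q : E} (hq : MapClusterPt q atTop γ) : g q = 0 := by
  by_contra hne
  have hcont : ContinuousOn γ (Ici 0) := by
    simpa [forwardInterval_top] using hγ.continuousOn
  obtain ⟨M, hM⟩ := (isCompact_closedBall (0 : E) R).exists_bound_of_continuousOn hg.continuousOn
  set M' : ℝ := max M 1
  have hM' : ∀ t, 0 ≤ t → ‖g (γ t)‖ ≤ M' := fun t ht =>
    (hM _ (mem_closedBall_zero_iff.2 (hR t ht))).trans (le_max_left _ _)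
  have hM0 : 0 < M' := lt_max_of_lt_right one_pos
  have hc : 0 < ‖g q‖ / 2 := by positivity
  obtain ⟨r, hr, hball⟩ : ∃ r > 0, ∀ x ∈ ball q r, ‖g q‖ / 2 < ‖g x‖ :=
    Metric.mem_nhds_iff.1
      (hg.norm.continuousAt.eventually (lt_mem_nhds (half_lt_self (norm_pos_iff.2 hne))))
  -- At speed at most `M'`, the orbit cannot go from the ball of radius `r / 2` out of the ball of
  -- radius `r` within this time.
  set h : ℝ := r / 2 / M'
  have hh : 0 < h := by positivity
  have hlower : ∀ t, 0 ≤ t → ∀ c : ℝ, ∀ u, t ≤ u → (∀ s ∈ Ico t u, c ≤ ‖g (γ s)‖ ^ 2) →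
      Φ (γ t) + c * (u - t) ≤ Φ (γ u) := by
    intro t ht c u htu hcs
    refine image_le_of_deriv_right_le_deriv_boundary (a := t) (b := u)
      (f := fun s => Φ (γ t) + c * (s - t)) (f' := fun _ => c) (B := fun s => Φ (γ s))
      (B' := fun s => ‖g (γ s)‖ ^ 2) (by fun_prop) (fun s _ => ?_) (by simp)
      (hΦ.comp_continuousOn (hcont.mono fun s hs => ht.trans hs.1))
      (fun s hs => hΦγ s (ht.trans hs.1)) hcs (right_mem_Icc.2 htu)
    simpa using ((((hasDerivAt_id s).sub_const t).const_mul c).const_add (Φ (γ t))).hasDerivWithinAt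
      (s := Ici s)
  have hmono : Monotone fun t => Φ (γ (max t 0)) := by
    intro t u htu
    have := hlower (max t 0) (le_max_right _ _) 0 (max u 0) (max_le_max_right 0 htu)
      (fun s _ => by positivity)
    simpa using this
  obtain ⟨D, hD⟩ := (isCompact_closedBall (0 : E) R).exists_bound_of_continuousOn hΦ.continuousOn
  have hbdd : BddAbove (range fun t => Φ (γ (max t 0))) := by
    refine ⟨D, ?_⟩
    rintro _ ⟨t, rfl⟩
    exact (le_abs_self _).trans (hD _ (mem_closedBall_zero_iff.2 (hR _ (le_max_right _ _))))
  have hlim := tendsto_atTop_ciSup hmono hbdd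
  have hdiff : Tendsto (fun t => Φ (γ (max (t + h) 0)) - Φ (γ (max t 0))) atTop (𝓝 0) := by
    simpa using (hlim.comp (tendsto_atTop_add_const_right atTop h tendsto_id)).sub hlim
  have hsmall := hdiff.eventually (gt_mem_nhds (show 0 < (‖g q‖ / 2) ^ 2 * h by positivity))
  have hfreq := hq.frequently (ball_mem_nhds q (half_pos hr))
  obtain ⟨t, ⟨htq, htΦ⟩, ht0⟩ :=
    ((hfreq.and_eventually hsmall).and_eventually (eventually_ge_atTop 0)).exists
  rw [max_eq_left ht0, max_eq_left (by linarith)] at htΦ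
  have := hlower t ht0 ((‖g q‖ / 2) ^ 2) (t + h) (by linarith) fun s hs => by
    refine pow_le_pow_left₀ hc.le (hball (γ s) ?_).le 2
    have hspeed := norm_image_sub_le_of_norm_deriv_right_le_segment (f := γ)
      (f' := fun s => g (γ s)) (a := t) (b := s) (C := M')
      (hcont.mono fun u hu => ht0.trans hu.1)
      (fun u hu => hγ.hasDerivWithinAt_Ici
        (by rw [forwardInterval_top]; exact ht0.trans hu.1))
      (fun u hu => hM' u (ht0.trans hu.1)) s (right_mem_Icc.2 hs.1)
    have h1 : M' * (s - t) ≤ M' * h := by gcongr; linarith [hs.2]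
    have h2 : M' * h = r / 2 := mul_div_cancel₀ _ hM0.ne'
    rw [← dist_eq_norm] at hspeed
    have h3 : dist (γ t) q < r / 2 := htq
    exact mem_ball.2 (by linarith [dist_triangle (γ s) (γ t) q])
  rw [add_sub_cancel_left] at this
  linarith

/-- A bounded solution of a gradient-like equation with isolated equilibria converges. -/
theorem IsForwardSolution.exists_tendsto (hg : Continuous g) (hΦ : Continuous Φ)
    (hγ : IsForwardSolution g ⊤ γ) (hR : ∀ t, 0 ≤ t → ‖γ t‖ ≤ R)
    (hΦγ : ∀ t, 0 ≤ t → HasDerivWithinAt (fun s => Φ (γ s)) (‖g (γ t)‖ ^ 2) (Ici t) t)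
    {K : Set E} (hK : IsClosed K) (hγK : ∀ t, 0 ≤ t → γ t ∈ K)
    (hiso : ∀ p ∈ K, g p = 0 → ∃ r > 0, ∀ q ∈ K, g q = 0 → dist q p < r → q = p) :
    ∃ p ∈ K, g p = 0 ∧ Tendsto γ atTop (𝓝 p) := by
  have hcont : ContinuousOn γ (Ici 0) := by
    simpa [forwardInterval_top] using hγ.continuousOn
  have hzero := fun q => hγ.apply_mapClusterPt_eq_zero hg hΦ hR hΦγ (q := q)
  have hcomp : IsCompact (K ∩ closedBall 0 R) := (isCompact_closedBall 0 R).inter_left hK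
  have hmem : ∀ᶠ t in atTop, γ t ∈ K ∩ closedBall 0 R := by
    filter_upwards [eventually_ge_atTop 0] with t ht
    exact ⟨hγK t ht, mem_closedBall_zero_iff.2 (hR t ht)⟩
  obtain ⟨p, hpK, hp⟩ := hcomp.exists_mapClusterPt_of_frequently hmem.frequently
  obtain ⟨r, hr, hr'⟩ := hiso p hpK.1 (hzero p hp)
  refine ⟨p, hpK.1, hzero p hp, ?_⟩
  by_contra hnot
  obtain ⟨ε, hε, hεfreq⟩ : ∃ ε > 0, ∃ᶠ t in atTop, ε ≤ dist (γ t) p := by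
    simpa only [Metric.tendsto_nhds, not_forall, exists_prop, not_eventually, not_lt] using hnot
  -- An orbit that returns near `p` without converging crosses this sphere at arbitrarily late
  -- times. Compactness gives a cluster point on it, an equilibrium too close to `p` since `ρ < r`.
  set ρ := min ε (r / 2)
  have hρ : 0 < ρ := lt_min hε (by linarith)
  have hfreq : ∃ᶠ t in atTop, γ t ∈ (K ∩ closedBall 0 R) ∩ sphere p ρ := by
    suffices h : ∃ᶠ t in atTop, γ t ∈ sphere p ρ from
      (h.and_eventually hmem).mono fun t ht => ⟨ht.2, ht.1⟩
    refine frequently_atTop.2 fun a => ?_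
    obtain ⟨t₁, ht₁, h₁⟩ := frequently_atTop.1 (hp.frequently (ball_mem_nhds p hρ)) (max a 0)
    obtain ⟨t₂, ht₂, h₂⟩ := frequently_atTop.1 hεfreq t₁
    obtain ⟨s, hs, hsρ⟩ := intermediate_value_Icc ht₂ (f := fun t => dist (γ t) p)
      ((continuous_id.dist (continuous_const (y := p))).comp_continuousOn
        (hcont.mono fun u hu => (le_max_right a 0).trans (ht₁.trans hu.1)))
      ⟨(mem_ball.1 h₁).le, (min_le_left _ _).trans h₂⟩
    exact ⟨s, (le_max_left a 0).trans (ht₁.trans hs.1), hsρ⟩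
  obtain ⟨q, hq, hqc⟩ :=
    (hcomp.inter_right isClosed_sphere).exists_mapClusterPt_of_frequently hfreq
  have hqρ : dist q p = ρ := hq.2
  have := hr' q hq.1.1 (hzero q hqc) (by rw [hqρ]; linarith [min_le_right ε (r / 2)])
  rw [this, dist_self] at hqρ
  exact hρ.ne hqρ

end Convergence

/-! ### Flows and cuts on graphs -/

theorem eq_of_forall_adj_eq {V : Type*} {G : SimpleGraph V} (hG : G.Connected) {d : V → ℝ} (h : ∀ i j, G.Adj i j → d i = d j)
    (i j : V) : d i = d j := by
  obtain ⟨p⟩ := hG.preconnected i j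
  induction p with
  | nil => rfl
  | cons hadj _ ih => exact (h _ _ hadj).trans ih

section GraphSums

variable {V : Type*} [Fintype V] (G : SimpleGraph V) [DecidableRel G.Adj]

theorem sum_neighborFinset_comm (F : V → V → ℝ) :
    ∑ i, ∑ j ∈ G.neighborFinset i, F i j = ∑ i, ∑ j ∈ G.neighborFinset i, F j i :=
  Finset.sum_comm' fun i j => by simp [G.adj_comm]

variable {G}

/-- Summation by parts for a flow on a graph. -/
theorem sum_mul_sum_neighborFinset (c : V → ℝ) {w : V → V → ℝ}
    (hw : ∀ i j, G.Adj i j → w i j = -w j i) :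
    ∑ i, c i * ∑ j ∈ G.neighborFinset i, w i j =
      1 / 2 * ∑ i, ∑ j ∈ G.neighborFinset i, (c i - c j) * w i j := by
  have h1 : ∑ i, ∑ j ∈ G.neighborFinset i, c j * w i j =
      -∑ i, ∑ j ∈ G.neighborFinset i, c i * w i j := by
    rw [sum_neighborFinset_comm, ← Finset.sum_neg_distrib]
    refine Finset.sum_congr rfl fun i _ => ?_
    rw [← Finset.sum_neg_distrib]
    refine Finset.sum_congr rfl fun j hj => ?_
    rw [hw j i ((G.mem_neighborFinset i j).1 hj).symm]
    ring
  simp only [sub_mul, Finset.sum_sub_distrib, h1, Finset.mul_sum]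
  ring

/-- The double sum runs over oriented edges, so the surviving edge contributes once in each
direction. -/
theorem sum_neighborFinset_eq_of_edge [DecidableEq V] {a b : V} (hab : G.Adj a b) {F : V → V → ℝ}
    (hF : ∀ i j, G.Adj i j → s(i, j) ≠ s(a, b) → F i j = 0) :
    ∑ i, ∑ j ∈ G.neighborFinset i, F i j = F a b + F b a := by
  have hne := hab.ne
  have h : ∀ i, ∀ j ∈ G.neighborFinset i,
      F i j = (if j = b then (if i = a then F a b else 0) else 0) +
        (if j = a then (if i = b then F b a else 0) else 0) := by
    intro i j hj
    have hij := (G.mem_neighborFinset i j).1 hj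
    by_cases he : s(i, j) = s(a, b)
    · rcases Sym2.eq_iff.1 he with ⟨rfl, rfl⟩ | ⟨rfl, rfl⟩ <;> simp [hne, hne.symm]
    · rw [hF i j hij he]
      have h1 : ¬(j = b ∧ i = a) := fun h => he (by rw [h.1, h.2])
      have h2 : ¬(j = a ∧ i = b) := fun h => he (by rw [h.1, h.2, Sym2.eq_swap])
      rw [← ite_and, ← ite_and, if_neg h1, if_neg h2, add_zero]
  have h' : ∀ i, ∑ j ∈ G.neighborFinset i, F i j =
      (if i = a then F a b else 0) + (if i = b then F b a else 0) := by
    intro i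
    rw [Finset.sum_congr rfl (h i), Finset.sum_add_distrib, Finset.sum_ite_eq', Finset.sum_ite_eq']
    simp only [SimpleGraph.mem_neighborFinset]
    by_cases hia : i = a
    · subst hia; simp [hab, hne]
    · by_cases hib : i = b
      · subst hib; simp [hab.symm, hne.symm]
      · simp [hia, hib]
  simp [h', Finset.sum_add_distrib]

/-- In a forest every edge is the boundary of a vertex set. -/
theorem exists_cut_of_isAcyclic (hG : G.IsAcyclic) {a b : V} (hab : G.Adj a b) :
    ∃ c : V → ℝ, c a - c b = 1 ∧ ∀ i j, G.Adj i j → s(i, j) ≠ s(a, b) → c i = c j := by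
  classical
  have hbr := SimpleGraph.isAcyclic_iff_forall_adj_isBridge.1 hG hab
  rw [SimpleGraph.isBridge_iff] at hbr
  -- The indicator of the component of `a` once the bridge is removed.
  refine ⟨fun i => if (G.deleteEdges {s(a, b)}).Reachable a i then 1 else 0, ?_, ?_⟩
  · simp [hbr]
  · intro i j hij hne
    have hadj : (G.deleteEdges {s(a, b)}).Adj i j := by
      rw [SimpleGraph.deleteEdges_adj]
      exact ⟨hij, hne⟩
    have : (G.deleteEdges {s(a, b)}).Reachable a i ↔ (G.deleteEdges {s(a, b)}).Reachable a j :=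
      ⟨fun h => h.trans hadj.reachable, fun h => h.trans hadj.symm.reachable⟩
    simp only [this]

/-- A divergence-free flow on a forest vanishes. -/
theorem eq_zero_of_sum_neighborFinset_eq_zero (hG : G.IsAcyclic) {w : V → V → ℝ}
    (hw : ∀ i j, G.Adj i j → w i j = -w j i) (h0 : ∀ i, ∑ j ∈ G.neighborFinset i, w i j = 0)
    {a b : V} (hab : G.Adj a b) : w a b = 0 := by
  classical
  obtain ⟨c, hc, hcut⟩ := exists_cut_of_isAcyclic hG hab
  have h := sum_mul_sum_neighborFinset c hw
  rw [sum_neighborFinset_eq_of_edge hab (F := fun i j => (c i - c j) * w i j)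
    (fun i j hij hne => by rw [hcut i j hij hne, sub_self, zero_mul]), hw b a hab.symm] at h
  simp only [h0, mul_zero, Finset.sum_const_zero] at h
  have : (c a - c b) * w a b = 0 := by linarith
  rwa [hc, one_mul] at this

end GraphSums

/-! ### The consensus field, its linearization and its potential -/

section ConsensusField

variable {n : ℕ} {G : SimpleGraph (Fin n)} {f : Sym2 (Fin n) → ℝ → ℝ}

local notation "𝔼" => EuclideanSpace ℝ (Fin n)

theorem mem_onesPerp {x : 𝔼} : x ∈ onesPerp n ↔ ∑ i, x i = 0 := by
  rw [onesPerp, Submodule.mem_orthogonal_singleton_iff_inner_right, PiLp.inner_apply]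
  simp

theorem coupling_antisymm (hodd : ∀ e ∈ G.edgeSet, Function.Odd (f e)) (x : 𝔼) (i j : Fin n)
    (hij : G.Adj i j) : f s(i, j) (x i - x j) = -f s(j, i) (x j - x i) := by
  rw [Sym2.eq_swap (a := j), ← hodd _ hij, neg_sub]

theorem coupling_deriv_symm (hodd : ∀ e ∈ G.edgeSet, Function.Odd (f e)) (x : 𝔼) (i j : Fin n)
    (hij : G.Adj i j) : deriv (f s(i, j)) (x i - x j) = deriv (f s(j, i)) (x j - x i) := by
  have h : (fun y => f s(i, j) (-y)) = fun y => -f s(i, j) y := funext (hodd _ hij)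
  have h2 := deriv_comp_neg (f s(i, j)) (x i - x j)
  rw [h, deriv.fun_neg, neg_sub, neg_inj] at h2
  rw [h2, Sym2.eq_swap]

theorem hasDerivAt_primitive (hC1 : ∀ e ∈ G.edgeSet, ContDiff ℝ 1 (f e)) {i j : Fin n}
    (hij : G.Adj i j) (y : ℝ) :
    HasDerivAt (fun y => ∫ u in (0 : ℝ)..y, f s(i, j) u) (f s(i, j) y) y :=
  ((hC1 _ hij).continuous.integral_hasStrictDerivAt 0 y).hasDerivAt

variable [DecidableRel G.Adj]

theorem consensusField_apply (x : 𝔼) (i : Fin n) :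
    consensusField G f x i = ∑ j ∈ G.neighborFinset i, f s(i, j) (x i - x j) := rfl

theorem inner_consensusField (hodd : ∀ e ∈ G.edgeSet, Function.Odd (f e)) (x y : 𝔼) :
    inner ℝ y (consensusField G f x) =
      1 / 2 * ∑ i, ∑ j ∈ G.neighborFinset i, (y i - y j) * f s(i, j) (x i - x j) := by
  rw [← sum_mul_sum_neighborFinset (fun i => y i) (coupling_antisymm hodd x), PiLp.inner_apply]
  exact Finset.sum_congr rfl fun i _ => mul_comm _ _

theorem sum_consensusField (hodd : ∀ e ∈ G.edgeSet, Function.Odd (f e)) (x : 𝔼) :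
    ∑ i, consensusField G f x i = 0 := by
  have h := sum_mul_sum_neighborFinset (fun _ => 1) (coupling_antisymm hodd x)
  simpa [consensusField_apply] using h

theorem IsForwardSolution.mem_onesPerp (hodd : ∀ e ∈ G.edgeSet, Function.Odd (f e))
    {T : EReal} {γ : ℝ → 𝔼} (hγ : IsForwardSolution (consensusField G f) T γ)
    (h0 : γ 0 ∈ onesPerp n) {t : ℝ} (ht : t ∈ forwardInterval T) : γ t ∈ onesPerp n := by
  have h := hγ.apply_eq_of_comp_eq_zero (∑ i, EuclideanSpace.proj i)
    (fun x => by simpa using sum_consensusField hodd x) ht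
  rw [NonlinearConsensus.mem_onesPerp] at h0 ⊢
  simpa [h0] using h

theorem contDiff_consensusField (hC1 : ∀ e ∈ G.edgeSet, ContDiff ℝ 1 (f e)) :
    ContDiff ℝ 1 (consensusField G f) := by
  rw [contDiff_euclidean]
  intro i
  simp only [consensusField_apply]
  refine ContDiff.sum fun j hj => ?_
  exact (hC1 s(i, j) ((G.mem_neighborFinset i j).1 hj)).comp (by fun_prop)

/-- The edge terms form an antisymmetric flow whose divergence is the field; without cycles, zero
divergence forces each term to vanish. -/
theorem consensusField_eq_zero_iff (hG : G.IsAcyclic)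
    (hodd : ∀ e ∈ G.edgeSet, Function.Odd (f e)) {p : 𝔼} :
    consensusField G f p = 0 ↔ ∀ i j, G.Adj i j → f s(i, j) (p i - p j) = 0 := by
  refine ⟨fun h i j hij => ?_, fun h => ?_⟩
  · refine eq_zero_of_sum_neighborFinset_eq_zero hG (coupling_antisymm hodd p) (fun i => ?_) hij
    rw [← consensusField_apply, h]
    rfl
  · ext i
    rw [consensusField_apply]
    exact Finset.sum_eq_zero fun j hj => h i j ((G.mem_neighborFinset i j).1 hj)

/-- The derivative of the consensus vector field at `p`, a weighted Laplacian. -/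
noncomputable def consensusDeriv (G : SimpleGraph (Fin n)) [DecidableRel G.Adj]
    (f : Sym2 (Fin n) → ℝ → ℝ) (p : 𝔼) : 𝔼 →L[ℝ] 𝔼 :=
  (EuclideanSpace.equiv (Fin n) ℝ).symm.toContinuousLinearMap ∘L
    ContinuousLinearMap.pi fun i => ∑ j ∈ G.neighborFinset i,
      deriv (f s(i, j)) (p i - p j) • (EuclideanSpace.proj i - EuclideanSpace.proj j)

theorem consensusDeriv_apply (p d : 𝔼) (i : Fin n) :
    consensusDeriv G f p d i =
      ∑ j ∈ G.neighborFinset i, deriv (f s(i, j)) (p i - p j) * (d i - d j) := by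
  simp [consensusDeriv]

theorem hasStrictFDerivAt_consensusField (hC1 : ∀ e ∈ G.edgeSet, ContDiff ℝ 1 (f e)) (p : 𝔼) :
    HasStrictFDerivAt (consensusField G f) (consensusDeriv G f p) p := by
  rw [hasStrictFDerivAt_euclidean]
  intro i
  have h : PiLp.proj 2 (fun _ => ℝ) i ∘L consensusDeriv G f p =
      ∑ j ∈ G.neighborFinset i, deriv (f s(i, j)) (p i - p j) •
        (EuclideanSpace.proj i - EuclideanSpace.proj j : 𝔼 →L[ℝ] ℝ) := by
    ext d
    simp [consensusDeriv]
  rw [h]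
  simp only [consensusField_apply]
  refine HasStrictFDerivAt.fun_sum fun j hj => ?_
  have hf := ((hC1 s(i, j) ((G.mem_neighborFinset i j).1 hj)).contDiffAt
    (x := p i - p j)).hasStrictDerivAt one_ne_zero
  exact hf.comp_hasStrictFDerivAt p
    (EuclideanSpace.proj i - EuclideanSpace.proj j : 𝔼 →L[ℝ] ℝ).hasStrictFDerivAt

theorem inner_consensusDeriv (hodd : ∀ e ∈ G.edgeSet, Function.Odd (f e)) (p d y : 𝔼) :
    inner ℝ y (consensusDeriv G f p d) = 1 / 2 * ∑ i, ∑ j ∈ G.neighborFinset i,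
      (y i - y j) * (deriv (f s(i, j)) (p i - p j) * (d i - d j)) := by
  rw [← sum_mul_sum_neighborFinset (fun i => y i)
    (w := fun i j => deriv (f s(i, j)) (p i - p j) * (d i - d j))
    (fun i j hij => by rw [coupling_deriv_symm hodd p i j hij]; ring), PiLp.inner_apply]
  refine Finset.sum_congr rfl fun i _ => ?_
  rw [consensusDeriv_apply]
  exact mul_comm _ _

theorem isSymmetric_consensusDeriv (hodd : ∀ e ∈ G.edgeSet, Function.Odd (f e)) (p : 𝔼) :
    (consensusDeriv G f p : 𝔼 →ₗ[ℝ] 𝔼).IsSymmetric := by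
  intro x y
  simp only [ContinuousLinearMap.coe_coe]
  rw [real_inner_comm, inner_consensusDeriv hodd, inner_consensusDeriv hodd]
  congr 1
  exact Finset.sum_congr rfl fun i _ => Finset.sum_congr rfl fun j _ => by ring

/-- On a tree, `⟨1⟩^⊥` meets the kernel of a Laplacian with nonzero weights trivially. -/
theorem exists_le_norm_consensusDeriv (hG : G.IsTree)
    (hodd : ∀ e ∈ G.edgeSet, Function.Odd (f e)) {p : 𝔼}
    (hp : ∀ i j, G.Adj i j → deriv (f s(i, j)) (p i - p j) ≠ 0) :
    ∃ c > 0, ∀ d ∈ onesPerp n, c * ‖d‖ ≤ ‖consensusDeriv G f p d‖ := by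
  have hker : LinearMap.ker ((consensusDeriv G f p : 𝔼 →ₗ[ℝ] 𝔼).domRestrict (onesPerp n)) = ⊥ := by
    rw [LinearMap.ker_eq_bot']
    rintro ⟨d, hd⟩ h
    have h0 : ∀ i, ∑ j ∈ G.neighborFinset i, deriv (f s(i, j)) (p i - p j) * (d i - d j) = 0 := by
      intro i
      rw [← consensusDeriv_apply]
      exact congrArg (fun v : 𝔼 => v i) h
    have hadj : ∀ i j, G.Adj i j → d i = d j := fun i j hij => by
      have := eq_zero_of_sum_neighborFinset_eq_zero hG.isAcyclic
        (w := fun i j => deriv (f s(i, j)) (p i - p j) * (d i - d j))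
        (fun i j hij => by rw [coupling_deriv_symm hodd p i j hij]; ring) h0 hij
      exact sub_eq_zero.1 ((mul_eq_zero.1 this).resolve_left (hp i j hij))
    have hconst := eq_of_forall_adj_eq hG.connected (d := fun i => d i) hadj
    ext i
    have hsum := mem_onesPerp.1 hd
    rw [Finset.sum_congr rfl fun j _ => hconst j i] at hsum
    have hn : n ≠ 0 := fun h => (h ▸ i).elim0
    simpa [hn] using hsum
  obtain ⟨K, hK, hanti⟩ := LinearMap.exists_antilipschitzWith _ hker
  refine ⟨(K : ℝ)⁻¹, by positivity, fun d hd => ?_⟩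
  have h := hanti.le_mul_norm_sub (⟨d, hd⟩ : onesPerp n) 0
  rw [inv_mul_le_iff₀ (by exact_mod_cast hK)]
  simpa using h

/-- Near a nondegenerate point, the field is close to its derivative, which is bounded below. -/
theorem exists_linear_approximation (hG : G.IsTree)
    (hodd : ∀ e ∈ G.edgeSet, Function.Odd (f e)) (hC1 : ∀ e ∈ G.edgeSet, ContDiff ℝ 1 (f e))
    {p : 𝔼} (hp : ∀ i j, G.Adj i j → deriv (f s(i, j)) (p i - p j) ≠ 0) :
    ∃ c > 0, ∃ r > 0, (∀ d ∈ onesPerp n, c * ‖d‖ ≤ ‖consensusDeriv G f p d‖) ∧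
      ∀ x ∈ ball p r, ∀ y ∈ ball p r, ‖consensusField G f x - consensusField G f y -
        consensusDeriv G f p (x - y)‖ ≤ c / 2 * ‖x - y‖ := by
  obtain ⟨c, hc, hlow⟩ := exists_le_norm_consensusDeriv hG hodd hp
  -- Strict differentiability controls differences between two moving points; `c / 2` is the error
  -- that the cone estimate can absorb.
  have h := (hasStrictFDerivAt_consensusField hC1 p).isLittleO.def (half_pos hc)
  rw [nhds_prod_eq] at h
  obtain ⟨s, hs, hsub⟩ := (eventually_prod_self_iff (r := fun x y => ‖consensusField G f x -
    consensusField G f y - consensusDeriv G f p (x - y)‖ ≤ c / 2 * ‖x - y‖)).1 h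
  obtain ⟨r, hr, hball⟩ := Metric.mem_nhds_iff.1 hs
  exact ⟨c, hc, r, hr, hlow, fun x hx y hy => hsub x (hball hx) y (hball hy)⟩

/-- The cut vector of the edge differs only across that edge, so its quadratic form is the weight of
the edge. Subtracting the mean puts it in ⟨1⟩^⊥ without changing differences. -/
theorem exists_inner_consensusDeriv_pos (hG : G.IsTree)
    (hodd : ∀ e ∈ G.edgeSet, Function.Odd (f e)) {p : 𝔼} {a b : Fin n} (hab : G.Adj a b)
    (hpos : 0 < deriv (f s(a, b)) (p a - p b)) :
    ∃ v ∈ onesPerp n, 0 < inner ℝ (consensusDeriv G f p v) v := by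
  obtain ⟨c, hc, hcut⟩ := exists_cut_of_isAcyclic hG.isAcyclic hab
  have hn : (n : ℝ) ≠ 0 := Nat.cast_ne_zero.2 fun h => (h ▸ a).elim0
  refine ⟨WithLp.toLp 2 fun i => c i - (∑ j, c j) / n, ?_, ?_⟩
  · rw [mem_onesPerp]
    simp [mul_div_cancel₀ _ hn]
  · rw [real_inner_comm, inner_consensusDeriv hodd]
    simp only [sub_sub_sub_cancel_right]
    rw [sum_neighborFinset_eq_of_edge hab
      (F := fun i j => (c i - c j) * (deriv (f s(i, j)) (p i - p j) * (c i - c j)))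
      (fun i j hij hne => by rw [hcut i j hij hne, sub_self, zero_mul]),
      ← coupling_deriv_symm hodd p a b hab]
    have : c b - c a = -1 := by linarith
    rw [hc, this]
    linarith

/-- Near a root with negative derivative, each coupling has the sign opposite to the displacement,
so every edge term is nonpositive and the squared distance to `p` serves as a Lyapunov function. -/
theorem exists_inner_consensusField_nonpos (hodd : ∀ e ∈ G.edgeSet, Function.Odd (f e)) {p : 𝔼}
    (hp : ∀ i j, G.Adj i j → f s(i, j) (p i - p j) = 0 ∧ deriv (f s(i, j)) (p i - p j) < 0) :
    ∃ r > 0, ∀ x ∈ ball p r, inner ℝ (x - p) (consensusField G f x) ≤ 0 := by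
  have h : ∀ᶠ x in 𝓝 p, ∀ i j, G.Adj i j →
      ((x i - x j) - (p i - p j)) * f s(i, j) (x i - x j) ≤ 0 := by
    simp only [eventually_all]
    intro i j hij
    have hs := eventually_nhdsWithin_sign_eq_of_deriv_neg (hp i j hij).2 (hp i j hij).1
    have hc : Tendsto (fun x : 𝔼 => x i - x j) (𝓝 p) (𝓝 (p i - p j)) :=
      Continuous.tendsto (by fun_prop) p
    filter_upwards [hc.eventually hs] with x hx
    rw [← sign_nonpos_iff, sign_mul, hx, ← neg_sub, Left.sign_neg]
    generalize SignType.sign (p i - p j - (x i - x j)) = σ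
    revert σ
    decide
  obtain ⟨r, hr, hball⟩ := Metric.mem_nhds_iff.1 h
  refine ⟨r, hr, fun x hx => ?_⟩
  rw [inner_consensusField hodd]
  refine mul_nonpos_of_nonneg_of_nonpos (by norm_num)
    (Finset.sum_nonpos fun i _ => Finset.sum_nonpos fun j hj => ?_)
  have := hball hx i j ((G.mem_neighborFinset i j).1 hj)
  simp only [PiLp.sub_apply]
  rwa [sub_sub_sub_comm]

/-- Minus the energy of the consensus dynamics, of which the vector field is the gradient. -/
noncomputable def consensusPotential (G : SimpleGraph (Fin n)) [DecidableRel G.Adj]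
    (f : Sym2 (Fin n) → ℝ → ℝ) (x : 𝔼) : ℝ :=
  1 / 2 * ∑ i, ∑ j ∈ G.neighborFinset i, ∫ y in (0 : ℝ)..(x i - x j), f s(i, j) y

theorem continuous_consensusPotential (hC1 : ∀ e ∈ G.edgeSet, ContDiff ℝ 1 (f e)) :
    Continuous (consensusPotential G f) := by
  refine continuous_const.mul (continuous_finsetSum _ fun i _ => continuous_finsetSum _ fun j hj => ?_)
  have hc : Continuous fun y => ∫ u in (0 : ℝ)..y, f s(i, j) u := continuous_iff_continuousAt.2
    fun y => (hasDerivAt_primitive hC1 ((G.mem_neighborFinset i j).1 hj) y).continuousAt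
  exact hc.comp (by fun_prop)

theorem hasDerivWithinAt_consensusPotential (hodd : ∀ e ∈ G.edgeSet, Function.Odd (f e))
    (hC1 : ∀ e ∈ G.edgeSet, ContDiff ℝ 1 (f e)) {γ : ℝ → 𝔼} {s : Set ℝ} {t : ℝ}
    (hγ : HasDerivWithinAt γ (consensusField G f (γ t)) s t) :
    HasDerivWithinAt (fun u => consensusPotential G f (γ u)) (‖consensusField G f (γ t)‖ ^ 2) s t := by
  have hcoord : ∀ i, HasDerivWithinAt (fun u => γ u i) (consensusField G f (γ t) i) s t :=
    fun i => (EuclideanSpace.proj (𝕜 := ℝ) i).hasFDerivAt.comp_hasDerivWithinAt t hγ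
  rw [← real_inner_self_eq_norm_sq, inner_consensusField hodd]
  refine HasDerivWithinAt.const_mul _ (HasDerivWithinAt.fun_sum fun i _ =>
    HasDerivWithinAt.fun_sum fun j hj => ?_)
  rw [mul_comm]
  exact (hasDerivAt_primitive hC1 ((G.mem_neighborFinset i j).1 hj) _).comp_hasDerivWithinAt t
    ((hcoord i).sub (hcoord j))

end ConsensusField

/-! ### Stable equilibria and null basins -/

section MainResult

variable {n : ℕ} {G : SimpleGraph (Fin n)} [DecidableRel G.Adj] {f : Sym2 (Fin n) → ℝ → ℝ}

local notation "𝔼" => EuclideanSpace ℝ (Fin n)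

theorem isForwardSolution_const {E : Type*} [NormedAddCommGroup E] [NormedSpace ℝ E] {g : E → E}
    {p : E} (hp : g p = 0) : IsForwardSolution g ⊤ fun _ => p :=
  ⟨EReal.zero_lt_top, fun t _ => by simpa [hp] using hasDerivWithinAt_const t _ p⟩

theorem IsForwardSolution.comp_add_const {E : Type*} [NormedAddCommGroup E] [NormedSpace ℝ E]
    {g : E → E} {γ : ℝ → E} (hγ : IsForwardSolution g ⊤ γ) {a : ℝ} (ha : 0 ≤ a) :
    IsForwardSolution g ⊤ fun t => γ (t + a) :=
  ⟨hγ.1, (hγ.2.comp_add a).mono fun t ht => by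
    rw [forwardInterval_top] at ht ⊢
    exact ⟨t + a, add_nonneg ht ha, by simp⟩⟩

/-- Two solutions that stay near a nondegenerate point differ by a vector in the cone where the
quadratic form of the linearization is nonpositive. -/
theorem inner_consensusDeriv_sub_nonpos (hodd : ∀ e ∈ G.edgeSet, Function.Odd (f e)) {p : 𝔼}
    {c r : ℝ} (hc : 0 < c) (hlow : ∀ d ∈ onesPerp n, c * ‖d‖ ≤ ‖consensusDeriv G f p d‖)
    (hlin : ∀ x ∈ ball p r, ∀ y ∈ ball p r, ‖consensusField G f x - consensusField G f y -
        consensusDeriv G f p (x - y)‖ ≤ c / 2 * ‖x - y‖)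
    {γ η : ℝ → 𝔼} (hγ : IsForwardSolution (consensusField G f) ⊤ γ)
    (hη : IsForwardSolution (consensusField G f) ⊤ η) (hγ0 : γ 0 ∈ onesPerp n)
    (hη0 : η 0 ∈ onesPerp n) (hγr : ∀ t, 0 ≤ t → γ t ∈ ball p r)
    (hηr : ∀ t, 0 ≤ t → η t ∈ ball p r) :
    inner ℝ (consensusDeriv G f p (γ 0 - η 0)) (γ 0 - η 0) ≤ 0 := by
  have hmem : ∀ t : ℝ, 0 ≤ t → t ∈ forwardInterval ⊤ := fun t ht => by
    rwa [forwardInterval_top]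
  refine inner_nonpos_of_bounded (d := fun t => γ t - η t)
    (d' := fun t => consensusField G f (γ t) - consensusField G f (η t)) (B := r + r)
    (isSymmetric_consensusDeriv hodd p) hc ?_ (fun t ht => ?_) (fun t ht => ?_)
    (fun t ht => hlin _ (hγr t ht) _ (hηr t ht)) (fun t ht => ?_)
  · rw [← forwardInterval_top]
    exact hγ.continuousOn.sub hη.continuousOn
  · exact (hγ.hasDerivWithinAt_Ici (hmem t ht)).sub (hη.hasDerivWithinAt_Ici (hmem t ht))
  · exact hlow _ (Submodule.sub_mem _ (hγ.mem_onesPerp hodd hγ0 (hmem t ht))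
      (hη.mem_onesPerp hodd hη0 (hmem t ht)))
  · rw [← dist_eq_norm]
    exact (dist_triangle_right _ _ p).trans (add_le_add (hγr t ht).le (hηr t ht).le)

/-- For instability, an orbit starting at `p + s • v`, with `v` in the positive cone, cannot stay
near the constant orbit `p`: the cone estimate would make the form nonpositive at `s • v`. -/
theorem isStableEquilibriumIn_onesPerp_iff (hG : G.IsTree)
    (hodd : ∀ e ∈ G.edgeSet, Function.Odd (f e)) (hC1 : ∀ e ∈ G.edgeSet, ContDiff ℝ 1 (f e))
    (hsimple : ∀ e ∈ G.edgeSet, ∀ y : ℝ, f e y = 0 → deriv (f e) y ≠ 0) {p : 𝔼} :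
    IsStableEquilibriumIn (consensusField G f) (onesPerp n) p ↔ p ∈ onesPerp n ∧
      ∀ i j, G.Adj i j → f s(i, j) (p i - p j) = 0 ∧ deriv (f s(i, j)) (p i - p j) < 0 := by
  have hg := contDiff_consensusField hC1
  refine ⟨fun ⟨hpK, hp0, hst⟩ => ⟨hpK, fun a b hab => ?_⟩, fun ⟨hpK, hp⟩ => ⟨hpK, ?_, ?_⟩⟩
  · have hroot := (consensusField_eq_zero_iff hG.isAcyclic hodd).1 hp0
    have hne := fun i j hij => hsimple s(i, j) hij _ (hroot i j hij)
    refine ⟨hroot a b hab, lt_of_not_ge fun hge => ?_⟩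
    obtain ⟨v, hvK, hv⟩ := exists_inner_consensusDeriv_pos hG hodd hab
      (lt_of_le_of_ne hge (hne a b hab).symm)
    obtain ⟨c, hc, r, hr, hlow, hlin⟩ := exists_linear_approximation hG hodd hC1 hne
    obtain ⟨δ, hδ, hδ'⟩ := hst r hr
    set s : ℝ := δ / (‖v‖ + 1)
    have hs : 0 < s := by positivity
    obtain ⟨T, γ, hγ, hγ0⟩ := exists_isMaximalForwardSolution hg (p + s • v)
    have hγK : γ 0 ∈ onesPerp n := by
      rw [hγ0]
      exact Submodule.add_mem _ hpK (Submodule.smul_mem _ s hvK)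
    obtain ⟨rfl, hstay⟩ := hδ' T γ hγ hγK (by
      rw [hγ0, dist_eq_norm, add_sub_cancel_left, norm_smul, Real.norm_of_nonneg hs.le]
      have h1 : s * (‖v‖ + 1) = δ := div_mul_cancel₀ _ (by positivity)
      linarith)
    have hle := inner_consensusDeriv_sub_nonpos hodd hc hlow hlin hγ.1
      (isForwardSolution_const hp0) hγK hpK hstay (fun _ _ => mem_ball_self hr)
    rw [hγ0, add_sub_cancel_left, map_smul, real_inner_smul_left, real_inner_smul_right] at hle
    have : 0 < s * (s * inner ℝ (consensusDeriv G f p v) v) := by positivity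
    linarith
  · exact (consensusField_eq_zero_iff hG.isAcyclic hodd).2 fun i j hij => (hp i j hij).1
  · intro ε hε
    obtain ⟨r, hr, hin⟩ := exists_inner_consensusField_nonpos hodd hp
    refine ⟨min ε r, lt_min hε hr, fun T γ hγ _ hd => ?_⟩
    obtain ⟨hT, hle⟩ := hγ.dist_le hg hin (hd.trans_le (min_le_right _ _))
    exact ⟨hT, fun t ht => (hle t ht).trans_lt (hd.trans_le (min_le_left _ _))⟩

/-- Equilibria with nonzero edge derivatives are isolated. -/
theorem exists_isolated_equilibrium (hG : G.IsTree)
    (hodd : ∀ e ∈ G.edgeSet, Function.Odd (f e)) (hC1 : ∀ e ∈ G.edgeSet, ContDiff ℝ 1 (f e))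
    (hsimple : ∀ e ∈ G.edgeSet, ∀ y : ℝ, f e y = 0 → deriv (f e) y ≠ 0) {p : 𝔼}
    (hpK : p ∈ onesPerp n) (hp0 : consensusField G f p = 0) :
    ∃ r > 0, ∀ q ∈ onesPerp n, consensusField G f q = 0 → dist q p < r → q = p := by
  have hroot := (consensusField_eq_zero_iff hG.isAcyclic hodd).1 hp0
  obtain ⟨c, hc, r, hr, hlow, hlin⟩ := exists_linear_approximation hG hodd hC1
    fun i j hij => hsimple s(i, j) hij _ (hroot i j hij)
  refine ⟨r, hr, fun q hqK hq0 hqr => ?_⟩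
  have h1 := hlin q hqr p (mem_ball_self hr)
  rw [hq0, hp0, sub_self, zero_sub, norm_neg] at h1
  -- Two equilibria in the ball give `c ‖q - p‖ ≤ ‖L (q - p)‖ ≤ c / 2 * ‖q - p‖`, where `L` is the
  -- linearization at `p`.
  have h2 := hlow _ (Submodule.sub_mem _ hqK hpK)
  rw [← sub_eq_zero, ← norm_le_zero_iff]
  nlinarith [norm_nonneg (q - p)]

theorem countable_equilibria (hG : G.IsTree)
    (hodd : ∀ e ∈ G.edgeSet, Function.Odd (f e)) (hC1 : ∀ e ∈ G.edgeSet, ContDiff ℝ 1 (f e))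
    (hsimple : ∀ e ∈ G.edgeSet, ∀ y : ℝ, f e y = 0 → deriv (f e) y ≠ 0) :
    {p : 𝔼 | p ∈ onesPerp n ∧ consensusField G f p = 0}.Countable := by
  have : DiscreteTopology {p : 𝔼 | p ∈ onesPerp n ∧ consensusField G f p = 0} := by
    refine discreteTopology_iff_isOpen_singleton.2 fun ⟨p, hpK, hp0⟩ => ?_
    obtain ⟨r, hr, h⟩ := exists_isolated_equilibrium hG hodd hC1 hsimple hpK hp0
    exact Metric.isOpen_singleton_iff.2 ⟨r, hr, fun q hq => Subtype.ext (h q q.2.1 q.2.2 hq)⟩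
  exact countable_coe_iff.1 (countable_of_Lindelof_of_discrete)

instance isAddHaarMeasure_lebesgueOnesPerp (n : ℕ) :
    (lebesgueOnesPerp n).IsAddHaarMeasure := by
  unfold lebesgueOnesPerp
  infer_instance

/-- Almost no bounded forward orbit converges to an equilibrium with an unstable edge. -/
theorem measure_basin_eq_zero (hG : G.IsTree)
    (hodd : ∀ e ∈ G.edgeSet, Function.Odd (f e)) (hC1 : ∀ e ∈ G.edgeSet, ContDiff ℝ 1 (f e))
    {p : 𝔼} (hne : ∀ i j, G.Adj i j → deriv (f s(i, j)) (p i - p j) ≠ 0) {a b : Fin n}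
    (hab : G.Adj a b) (hpos : 0 < deriv (f s(a, b)) (p a - p b)) :
    lebesgueOnesPerp n {x₀ : onesPerp n | ∃ γ : ℝ → 𝔼, IsForwardSolution (consensusField G f) ⊤ γ ∧
      γ 0 = x₀ ∧ (∃ R, ∀ t, 0 ≤ t → ‖γ t‖ ≤ R) ∧ Tendsto γ atTop (𝓝 p)} = 0 := by
  obtain ⟨v, hvK, hv⟩ := exists_inner_consensusDeriv_pos hG hodd hab hpos
  obtain ⟨c, hc, r, hr, hlow, hlin⟩ := exists_linear_approximation hG hodd hC1 hne
  set W : Set (onesPerp n) := {x₀ | ∃ γ : ℝ → 𝔼, IsForwardSolution (consensusField G f) ⊤ γ ∧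
    γ 0 = x₀ ∧ ∀ t, 0 ≤ t → γ t ∈ ball p r}
  have hW : lebesgueOnesPerp n W = 0 := by
    refine measure_eq_zero_of_quadratic_nonpos (lebesgueOnesPerp n)
      (q := fun x => inner ℝ (consensusDeriv G f p x) (x : 𝔼)) (by fun_prop) (fun s x => ?_)
      (v := ⟨v, hvK⟩) hv ?_
    · rw [Submodule.coe_smul, map_smul, real_inner_smul_left, real_inner_smul_right]
      ring
    · rintro x ⟨γ, hγ, hγ0, hγr⟩ y ⟨η, hη, hη0, hηr⟩
      have := inner_consensusDeriv_sub_nonpos hodd hc hlow hlin hγ hη (hγ0 ▸ x.2) (hη0 ▸ y.2)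
        hγr hηr
      rwa [hγ0, hη0] at this
  -- Sorting by the entry time `N` into the ball around `p` and by a norm bound `R` gives, on each
  -- piece, one Lipschitz constant `K`. The time-`N` map into `W` then has an inverse with constant
  -- `exp (K * N)`.
  set A : ℕ → ℕ → Set (onesPerp n) := fun N R => {x₀ | ∃ γ : ℝ → 𝔼,
    IsForwardSolution (consensusField G f) ⊤ γ ∧ γ 0 = x₀ ∧ (∀ t, 0 ≤ t → γ t ∈ closedBall 0 R) ∧
      ∀ t, (N : ℝ) ≤ t → γ t ∈ ball p r} with hAdef
  have hA : ∀ N R, lebesgueOnesPerp n (A N R) = 0 := by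
    intro N R
    have hex : ∀ x ∈ A N R, ∃ γ : ℝ → 𝔼, ∃ y : onesPerp n,
        IsForwardSolution (consensusField G f) ⊤ γ ∧ γ 0 = x ∧
        (∀ t, 0 ≤ t → γ t ∈ closedBall 0 R) ∧ (∀ t, (N : ℝ) ≤ t → γ t ∈ ball p r) ∧ y = γ N := by
      rintro x ⟨γ, hγ, h0, hR, hN⟩
      exact ⟨γ, ⟨γ N, hγ.mem_onesPerp hodd (h0 ▸ x.2)
        (by rw [forwardInterval_top]; exact mem_Ici.2 N.cast_nonneg)⟩, hγ, h0, hR, hN, rfl⟩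
    choose! γ φ hγ h0 hR hN hφ using hex
    obtain ⟨K, hK⟩ := exists_lipschitzOnWith_closedBall (contDiff_consensusField hC1) R
    refine measure_eq_zero_of_dist_le (lebesgueOnesPerp n) (W := W) (φ := φ)
      (fun x hx => ⟨fun t => γ x (t + N), (hγ x hx).comp_add_const N.cast_nonneg, ?_, ?_⟩)
      (C := Real.toNNReal (Real.exp (K * N))) (fun x hx y hy => ?_) hW
    · simp [hφ x hx]
    · exact fun t ht => hN x hx _ (by linarith)
    · have h := dist_zero_le_of_lipschitzOnWith hK (hγ x hx) (hγ y hy) (hR x hx) (hR y hy)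
        (t := N) N.cast_nonneg
      rw [h0 x hx, h0 y hy, ← hφ x hx, ← hφ y hy] at h
      rw [Real.coe_toNNReal _ (Real.exp_pos _).le, mul_comm]
      exact h
  refine measure_mono_null ?_ (measure_iUnion_null fun N => measure_iUnion_null (hA N))
  rintro x ⟨γ, hγ, h0, ⟨R, hR⟩, hlim⟩
  obtain ⟨t₀, ht₀⟩ := eventually_atTop.1 (hlim.eventually (ball_mem_nhds p hr))
  obtain ⟨N, hN⟩ := exists_nat_ge t₀
  obtain ⟨R', hR'⟩ := exists_nat_ge R
  exact mem_iUnion.2 ⟨N, mem_iUnion.2 ⟨R', γ, hγ, h0,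
    fun t ht => mem_closedBall_zero_iff.2 ((hR t ht).trans hR'), fun t ht => ht₀ t (hN.trans ht)⟩⟩

theorem IsMaximalForwardSolution.exists_tendsto_equilibrium (hG : G.IsTree)
    (hodd : ∀ e ∈ G.edgeSet, Function.Odd (f e)) (hC1 : ∀ e ∈ G.edgeSet, ContDiff ℝ 1 (f e))
    (hsimple : ∀ e ∈ G.edgeSet, ∀ y : ℝ, f e y = 0 → deriv (f e) y ≠ 0) {T : EReal} {γ : ℝ → 𝔼}
    (hγ : IsMaximalForwardSolution (consensusField G f) T γ) (h0 : γ 0 ∈ onesPerp n)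
    (hb : Bornology.IsBounded (γ '' forwardInterval T)) :
    T = ⊤ ∧ (∃ R, ∀ t, 0 ≤ t → ‖γ t‖ ≤ R) ∧
      ∃ p ∈ onesPerp n, consensusField G f p = 0 ∧ Tendsto γ atTop (𝓝 p) := by
  have hg := contDiff_consensusField hC1
  obtain ⟨R, hR⟩ := hb.exists_norm_le
  obtain rfl := hγ.eq_top_of_bounded hg (R := R) fun t ht => hR _ (mem_image_of_mem γ ht)
  have hmem : ∀ t : ℝ, 0 ≤ t → t ∈ forwardInterval ⊤ := fun t ht => by
    rwa [forwardInterval_top]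
  have hR' : ∀ t, 0 ≤ t → ‖γ t‖ ≤ R := fun t ht => hR _ (mem_image_of_mem γ (hmem t ht))
  exact ⟨rfl, ⟨R, hR'⟩, hγ.1.exists_tendsto hg.continuous (continuous_consensusPotential hC1) hR'
    (fun t ht => hasDerivWithinAt_consensusPotential hodd hC1
      (hγ.1.hasDerivWithinAt_Ici (hmem t ht)))
    (Submodule.closed_of_finiteDimensional (onesPerp n))
    (fun t ht => hγ.1.mem_onesPerp hodd h0 (hmem t ht))
    (fun p hpK hp0 => exists_isolated_equilibrium hG hodd hC1 hsimple hpK hp0)⟩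

/-- Almost every forward orbit converges to a stable equilibrium or is unbounded. -/
theorem ae_tendsto_stable_or_unbounded (hG : G.IsTree)
    (hodd : ∀ e ∈ G.edgeSet, Function.Odd (f e)) (hC1 : ∀ e ∈ G.edgeSet, ContDiff ℝ 1 (f e))
    (hsimple : ∀ e ∈ G.edgeSet, ∀ y : ℝ, f e y = 0 → deriv (f e) y ≠ 0) :
    ∀ᵐ x₀ : onesPerp n ∂(lebesgueOnesPerp n), ∀ (T : EReal) (γ : ℝ → 𝔼),
      IsMaximalForwardSolution (consensusField G f) T γ → γ 0 = x₀ →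
        (T = ⊤ ∧ ∃ p : 𝔼, IsStableEquilibriumIn (consensusField G f) (onesPerp n) p ∧
          Tendsto γ atTop (𝓝 p)) ∨
        ¬ Bornology.IsBounded (γ '' forwardInterval T) := by
  have hnull : ∀ p ∈ {p | p ∈ onesPerp n ∧
        consensusField G f p = 0},
      ∀ᵐ x₀ : onesPerp n ∂(lebesgueOnesPerp n),
        ¬ IsStableEquilibriumIn (consensusField G f)
          (onesPerp n) p →
        ¬ ∃ γ, IsForwardSolution (consensusField G f) ⊤ γ ∧
          γ 0 = x₀ ∧ (∃ R, ∀ t, 0 ≤ t → ‖γ t‖ ≤ R) ∧ Tendsto γ atTop (𝓝 p) := by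
    rintro p ⟨hpK, hp0⟩
    by_cases hst : IsStableEquilibriumIn (consensusField G f)
      (onesPerp n) p
    · exact Eventually.of_forall fun _ h => absurd hst h
    have hroot := (consensusField_eq_zero_iff hG.isAcyclic hodd).1 hp0
    have hne := fun i j hij => hsimple s(i, j) hij _ (hroot i j hij)
    rw [isStableEquilibriumIn_onesPerp_iff hG hodd hC1 hsimple] at hst
    obtain ⟨a, b, hab, hpos⟩ : ∃ a b, G.Adj a b ∧ 0 ≤ deriv (f s(a, b)) (p a - p b) := by
      by_contra! h
      exact hst ⟨hpK, fun i j hij => ⟨hroot i j hij, h i j hij⟩⟩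
    have := measure_basin_eq_zero hG hodd hC1 hne hab
      (lt_of_le_of_ne hpos (hne a b hab).symm)
    filter_upwards [measure_eq_zero_iff_ae_notMem.1 this] with x₀ hx₀ _ using hx₀
  -- Countability of the equilibria allows one almost-everywhere set to avoid all unstable basins at
  -- once.
  filter_upwards [(ae_ball_iff
    (countable_equilibria hG hodd hC1 hsimple)).2 hnull] with x₀ hx₀ T γ hγ h0
  refine or_iff_not_imp_right.2 fun hb => ?_
  obtain ⟨rfl, hR, p, hpK, hp0, hlim⟩ := hγ.exists_tendsto_equilibrium hG hodd hC1 hsimple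
    (h0 ▸ x₀.2) (not_not.1 hb)
  exact ⟨rfl, p, by_contra fun hst => hx₀ p ⟨hpK, hp0⟩ hst ⟨γ, hγ.1, h0, hR, hlim⟩, hlim⟩

end MainResult

end NonlinearConsensus

theorem mainTheorem9 (n : ℕ) (G : SimpleGraph (Fin n)) [DecidableRel G.Adj] (hG : G.IsTree)
    (f : Sym2 (Fin n) → ℝ → ℝ)
    (hodd : ∀ e ∈ G.edgeSet, Function.Odd (f e))
    (hC1 : ∀ e ∈ G.edgeSet, ContDiff ℝ 1 (f e))
    (hsimple : ∀ e ∈ G.edgeSet, ∀ y : ℝ, f e y = 0 → deriv (f e) y ≠ 0) :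
    -- every initial point has a forward orbit, i.e. a forward solution up to a maximal time
    (∀ x₀ : NonlinearConsensus.onesPerp n, ∃ (T : EReal) (γ : ℝ → EuclideanSpace ℝ (Fin n)),
      NonlinearConsensus.IsMaximalForwardSolution (NonlinearConsensus.consensusField G f) T γ ∧
        γ 0 = x₀) ∧
    -- almost every forward orbit converges to a stable equilibrium or is unbounded
    (∀ᵐ x₀ : NonlinearConsensus.onesPerp n ∂(NonlinearConsensus.lebesgueOnesPerp n),
      ∀ (T : EReal) (γ : ℝ → EuclideanSpace ℝ (Fin n)),
        NonlinearConsensus.IsMaximalForwardSolution (NonlinearConsensus.consensusField G f) T γ →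
        γ 0 = x₀ →
          (T = ⊤ ∧ ∃ p : EuclideanSpace ℝ (Fin n),
            NonlinearConsensus.IsStableEquilibriumIn (NonlinearConsensus.consensusField G f)
              (NonlinearConsensus.onesPerp n) p ∧ Tendsto γ atTop (𝓝 p)) ∨
          ¬ Bornology.IsBounded (γ '' NonlinearConsensus.forwardInterval T)) ∧
    -- description of the stable equilibria
    {p : EuclideanSpace ℝ (Fin n) |
        NonlinearConsensus.IsStableEquilibriumIn (NonlinearConsensus.consensusField G f)
          (NonlinearConsensus.onesPerp n) p} =
      {x : EuclideanSpace ℝ (Fin n) | x ∈ NonlinearConsensus.onesPerp n ∧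
        ∀ i j : Fin n, G.Adj i j →
          f s(i, j) (x i - x j) = 0 ∧ deriv (f s(i, j)) (x i - x j) < 0} := by
  exact ⟨fun x₀ => NonlinearConsensus.exists_isMaximalForwardSolution
      (NonlinearConsensus.contDiff_consensusField hC1) x₀,
    NonlinearConsensus.ae_tendsto_stable_or_unbounded hG hodd hC1 hsimple,
    Set.ext fun _ => NonlinearConsensus.isStableEquilibriumIn_onesPerp_iff hG hodd hC1 hsimple⟩
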